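/- For $d\ge 1$ let $\mathrm{SO}(d)$ be the group of real $d\times d$ matrices $M$ with $M^TM=I_d$ and $\det M=1$, acting on the Euclidean unit sphere $S^{d-1}=\{x\in\mathbb{R}^d : \|x\|_2=1\}$ by matrix-vector multiplication. For $\gamma_1,\dots,\gamma_r\in\mathrm{SO}(d)$, the sphere $S^{d-1}$ is called $(\gamma_1,\dots,\gamma_r)$-divisible if there is a (not necessarily measurable) set $A\subseteq S^{d-1}$ whose translates $\gamma_1.A,\dots,\gamma_r.A$ partition $S^{d-1}$, that is, for every $x\in S^{d-1}$ there are unique $y\in A$ and $i\in\{1,\dots,r\}$ such that $x=\gamma_i.y$. Proposition 1.5. Let $d\ge 3$ be odd and let $r\ge 3$. Suppose that $\gamma_1,\dots,\gamma_r\in\mathrm{SO}(d)$ generate a finite subgroup of $\mathrm{SO}(d)$. Then $S^{d-1}$ is not $(\gamma_1,\dots,\gamma_r)$-divisible. -/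

import Mathlib

/-- The action of a rotation `g ∈ SO(d)` on Euclidean space `ℝ^d`: the matrix-vector product. -/
noncomputable def rotate {d : ℕ} (g : Matrix.specialOrthogonalGroup (Fin d) ℝ)
    (x : EuclideanSpace ℝ (Fin d)) : EuclideanSpace ℝ (Fin d) :=
  WithLp.toLp 2 (Matrix.mulVec (g : Matrix (Fin d) (Fin d) ℝ) (WithLp.ofLp x))

/-- The unit sphere `S^{d-1}` of `ℝ^d` is `(γ_1, …, γ_r)`-divisible: there is a (not necessarily
measurable) subset `A` of the sphere such that every point `x` of the sphere can be written as
`x = γ_i y` for a unique pair of an index `i` and a point `y ∈ A`. -/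
def SphereDivisible {d r : ℕ} (γ : Fin r → Matrix.specialOrthogonalGroup (Fin d) ℝ) : Prop :=
  ∃ A : Set (EuclideanSpace ℝ (Fin d)),
    A ⊆ Metric.sphere (0 : EuclideanSpace ℝ (Fin d)) 1 ∧
    ∀ x ∈ Metric.sphere (0 : EuclideanSpace ℝ (Fin d)) 1,
      ∃! p : Fin r × EuclideanSpace ℝ (Fin d), p.2 ∈ A ∧ x = rotate (γ p.1) p.2

open scoped commutatorElement

/-! If translates of `A` partition the sphere, `r` divides the size of every orbit of the finite
group `G` on it. For a prime power `p ^ k` dividing `r`, `Sylow.pow_dvd_card_orbit` passes this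
divisibility to the orbits of a Sylow `p`-subgroup `P`. As `P` is nilpotent and `d` is odd, `P` has
a common real eigenvector; normalised to `w`, its orbit lies in `{w, -w}`. Hence `p ^ k ∣ 2` for all
such powers, so `r ∣ 2`, which is impossible.

The eigenvector comes by induction on dimension: a non-scalar operator `ρ g` commuting with the
whole action gives a proper invariant subspace of odd dimension, and if there is none, nilpotency
makes the action scalar. -/

/-- A real polynomial of odd degree has a root; here for monic polynomials. -/
theorem Polynomial.Monic.exists_isRoot_of_odd_natDegree {p : Polynomial ℝ} (hp : p.Monic)
    (hodd : Odd p.natDegree) : ∃ x, p.IsRoot x := by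
  have hdeg : 0 < p.degree := Polynomial.natDegree_pos_iff_degree_pos.mp hodd.pos
  have hpos : ∃ b, 0 ≤ p.eval b :=
    ((p.tendsto_atTop_of_leadingCoeff_nonneg hdeg (by simp [hp.leadingCoeff])).eventually_ge_atTop
      0).exists
  have hneg : ∃ a, p.eval a ≤ 0 := by
    -- As the degree is odd, `-p(-X)` is again monic, so the previous argument applies to it.
    have hnat : (-p.comp (-Polynomial.X)).natDegree = p.natDegree := by
      rw [Polynomial.natDegree_neg, Polynomial.natDegree_comp]; simp
    have hlead : (-p.comp (-Polynomial.X)).leadingCoeff = 1 := by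
      rw [Polynomial.leadingCoeff_neg, Polynomial.leadingCoeff_comp (by simp)]
      simp [hp.leadingCoeff, hodd.neg_one_pow]
    have hdeg' : 0 < (-p.comp (-Polynomial.X)).degree := by
      rw [← Polynomial.natDegree_pos_iff_degree_pos, hnat]; exact hodd.pos
    obtain ⟨b, hb⟩ := ((Polynomial.tendsto_atTop_of_leadingCoeff_nonneg _ hdeg'
      (by simp [hlead])).eventually_ge_atTop 0).exists
    exact ⟨-b, by simpa using hb⟩
  obtain ⟨a, ha⟩ := hneg
  obtain ⟨b, hb⟩ := hpos
  obtain ⟨x, hx⟩ := mem_range_of_exists_le_of_exists_ge p.continuous ⟨a, ha⟩ ⟨b, hb⟩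
  exact ⟨x, hx⟩

/-- An endomorphism of an odd-dimensional real vector space has a real eigenvalue. -/
theorem Module.End.exists_hasEigenvalue_of_odd_finrank {V : Type*} [AddCommGroup V] [Module ℝ V]
    [FiniteDimensional ℝ V] (hodd : Odd (Module.finrank ℝ V)) (f : Module.End ℝ V) :
    ∃ c : ℝ, f.HasEigenvalue c := by
  obtain ⟨c, hc⟩ := (LinearMap.charpoly_monic f).exists_isRoot_of_odd_natDegree
    (by rwa [LinearMap.charpoly_natDegree])
  exact ⟨c, (Module.End.hasEigenvalue_iff_isRoot_charpoly f c).mpr hc⟩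

/-- In odd dimension, two elements of a group whose commutator acts as a scalar act by commuting
endomorphisms. -/
theorem Representation.commute_of_commutator_eq_smul_one {G V : Type*} [Group G] [AddCommGroup V]
    [Module ℝ V] (ρ : Representation ℝ G V)
    (hodd : Odd (Module.finrank ℝ V)) {g h : G} {c : ℝ} (hc : ρ ⁅g, h⁆ = c • 1) :
    Commute (ρ g) (ρ h) := by
  have hdet : LinearMap.det (ρ ⁅g, h⁆) = 1 := by
    -- Determinants take values in a commutative group of units, so they kill commutators; then `c ^
    -- dim V = 1` with an odd exponent.
    have key : ((LinearMap.det : Module.End ℝ V →* ℝ).comp ρ) ⁅g, h⁆ = 1 := by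
      have hone := map_commutatorElement
        ((LinearMap.det : Module.End ℝ V →* ℝ).comp ρ).toHomUnits g h
      rw [commutatorElement_eq_one_iff_mul_comm.mpr (mul_comm (_ : ℝˣ) _)] at hone
      exact congrArg Units.val hone
    simpa using key
  have hc1 : c = 1 := by
    rw [hc, LinearMap.det_smul, map_one, mul_one] at hdet
    exact hodd.pow_inj.mp (hdet.trans (one_pow _).symm)
  rw [Commute, SemiconjBy, ← map_mul, ← map_mul]
  calc ρ (g * h) = ρ (⁅g, h⁆ * (h * g)) := by congr 1; simp [commutatorElement_def, mul_assoc]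
    _ = ρ (h * g) := by rw [map_mul, hc, hc1, one_smul, one_mul]

/-- If every endomorphism `ρ g` commuting with the whole of `ρ` is a scalar, and `G` is nilpotent,
then in odd dimension `ρ` is scalar. -/
theorem Representation.exists_eq_smul_one_of_isNilpotent {G V : Type*} [Group G]
    [Group.IsNilpotent G] [AddCommGroup V] [Module ℝ V]
    (ρ : Representation ℝ G V) (hodd : Odd (Module.finrank ℝ V))
    (hcomm : ∀ g, (∀ h, Commute (ρ g) (ρ h)) → ∃ c : ℝ, ρ g = c • 1) (g : G) :
    ∃ c : ℝ, ρ g = c • 1 := by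
  obtain ⟨n, hn⟩ := (Group.isNilpotent_iff G).mp ‹_›
  have key : ∀ n, ∀ g ∈ Subgroup.upperCentralSeries G n, ∃ c : ℝ, ρ g = c • 1 := by
    intro n
    induction n with
    | zero =>
      intro g hg
      rw [Subgroup.upperCentralSeries_zero, Subgroup.mem_bot] at hg
      exact ⟨1, by simp [hg]⟩
    | succ n ih =>
      intro g hg
      refine hcomm g fun h ↦ ?_
      -- Commutators with `g` lie one step lower in the central series, so they already act as
      -- scalars.
      obtain ⟨c, hc⟩ := ih _ (Subgroup.mem_upperCentralSeries_succ_iff.mp hg h)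
      exact ρ.commute_of_commutator_eq_smul_one hodd hc
  exact key n g (hn ▸ Subgroup.mem_top g)

/-- A nilpotent group acting linearly on an odd-dimensional real vector space has a common
eigenvector. -/
theorem Representation.exists_common_eigenvector_of_isNilpotent {G : Type*} [Group G]
    [Group.IsNilpotent G] (n : ℕ) : ∀ {V : Type*} [AddCommGroup V] [Module ℝ V]
    (ρ : Representation ℝ G V), Module.finrank ℝ V = n → Odd n →
    ∃ v : V, v ≠ 0 ∧ ∀ g, ∃ c : ℝ, ρ g v = c • v := by
  induction n using Nat.strong_induction_on with
  | _ n ih =>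
  intro V _ _ ρ hn hodd
  have hfin : FiniteDimensional ℝ V := Module.finite_of_finrank_pos (hn ▸ hodd.pos)
  have of_subspace : ∀ W : Submodule ℝ V, (∀ g, W ≤ W.comap (ρ g)) → Module.finrank ℝ W < n →
      Odd (Module.finrank ℝ W) → ∃ v : V, v ≠ 0 ∧ ∀ g, ∃ c : ℝ, ρ g v = c • v := by
    intro W hW hlt hWodd
    obtain ⟨v, hv, h⟩ := ih _ hlt (ρ.subrepresentation W hW) rfl hWodd
    refine ⟨v, by simpa using hv, fun g ↦ ?_⟩
    obtain ⟨c, hc⟩ := h g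
    exact ⟨c, congrArg Subtype.val hc⟩
  by_cases hs : ∀ g, (∀ h, Commute (ρ g) (ρ h)) → ∃ c : ℝ, ρ g = c • 1
  · have : Nontrivial V := Module.nontrivial_of_finrank_pos (hn ▸ hodd.pos)
    obtain ⟨v, hv⟩ := exists_ne (0 : V)
    refine ⟨v, hv, fun g ↦ ?_⟩
    obtain ⟨c, hc⟩ := ρ.exists_eq_smul_one_of_isNilpotent (hn ▸ hodd) hs g
    exact ⟨c, by simp [hc]⟩
  · push Not at hs
    obtain ⟨g, hg, hns⟩ := hs
    obtain ⟨c, hc⟩ := Module.End.exists_hasEigenvalue_of_odd_finrank (hn ▸ hodd) (ρ g)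
    set f : Module.End ℝ V := ρ g - c • 1 with hf
    have hfcomm : ∀ h v, f (ρ h v) = ρ h (f v) := fun h v ↦ by
      have := LinearMap.congr_fun (hg h) v
      simp only [Module.End.mul_apply] at this
      simp [hf, this]
    have hsum := LinearMap.finrank_range_add_finrank_ker f
    have hker : 0 < Module.finrank ℝ (LinearMap.ker f) := by
      obtain ⟨v, hv⟩ := hc.exists_hasEigenvector
      have : Nontrivial (LinearMap.ker f) :=
        ⟨⟨⟨v, by simp [hf, hv.apply_eq_smul]⟩, 0, by simpa [Subtype.ext_iff] using hv.2⟩⟩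
      exact Module.finrank_pos
    have hrange : 0 < Module.finrank ℝ (LinearMap.range f) := by
      rw [Nat.pos_iff_ne_zero]
      intro h0
      have : f = 0 := LinearMap.range_eq_bot.mp (Submodule.finrank_eq_zero.mp h0)
      exact hns c (sub_eq_zero.mp this)
    -- Kernel and range are both nonzero with dimensions summing to the odd `n`, so both are proper
    -- and exactly one has odd dimension.
    rcases Nat.even_or_odd (Module.finrank ℝ (LinearMap.ker f)) with he | ho
    · refine of_subspace (LinearMap.range f) ?_ (by omega) (by grind)
      rintro h _ ⟨v, rfl⟩
      exact ⟨ρ h v, hfcomm h v⟩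
    · refine of_subspace (LinearMap.ker f) ?_ (by omega) ho
      intro h v hv
      rw [LinearMap.mem_ker] at hv
      simp [hfcomm, hv]

/-- If an orbit is partitioned by the translates of a set by `r` group elements, then `r` divides
its size. -/
theorem MulAction.dvd_card_orbit_of_existsUnique {G X : Type*} [Group G] [MulAction G X] {r : ℕ}
    (γ : Fin r → G) (A : Set X) (x : X)
    (h : ∀ y ∈ MulAction.orbit G x, ∃! p : Fin r × X, p.2 ∈ A ∧ y = γ p.1 • p.2) :
    r ∣ Nat.card (MulAction.orbit G x) := by
  have hbij : Function.Bijective (fun p : Fin r × ↥(A ∩ MulAction.orbit G x) ↦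
      (⟨γ p.1 • (p.2 : X), MulAction.mem_orbit_of_mem_orbit _ p.2.2.2⟩ : MulAction.orbit G x)) := by
    constructor
    · rintro ⟨i, y, hyA, hyO⟩ ⟨j, z, hzA, hzO⟩ heq
      have heq : γ i • y = γ j • z := congrArg Subtype.val heq
      have := (h _ (MulAction.mem_orbit_of_mem_orbit (γ i) hyO)).unique
        (y₁ := (i, y)) (y₂ := (j, z)) ⟨hyA, rfl⟩ ⟨hzA, heq⟩
      simp_all
    · rintro ⟨y, hy⟩
      obtain ⟨⟨i, z⟩, ⟨hz, hyz⟩, -⟩ := h y hy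
      refine ⟨(i, ⟨z, hz, ?_⟩), Subtype.ext hyz.symm⟩
      rw [show z = (γ i)⁻¹ • y by simp [hyz]]
      exact MulAction.mem_orbit_of_mem_orbit _ hy
  rw [← Nat.card_congr (Equiv.ofBijective _ hbij), Nat.card_prod, Nat.card_fin]
  exact dvd_mul_right _ _

/-- The `p`-part of the size of an orbit divides the size of the orbit under a Sylow
`p`-subgroup. -/
theorem Sylow.pow_dvd_card_orbit {G X : Type*} [Group G] [Finite G] [MulAction G X] {p k : ℕ}
    [hp : Fact p.Prime] (P : Sylow p G) (x : X) (h : p ^ k ∣ Nat.card (MulAction.orbit G x)) :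
    p ^ k ∣ Nat.card (MulAction.orbit P x) := by
  -- With `S` the stabilizer of `x` in `G`, `|Gx| = [G : S]` divides `[G : S ∩ P] = |Px| * [G : P]`,
  -- and `p` does not divide `[G : P]`.
  have hcop : Nat.Coprime (p ^ k) (P : Subgroup G).index :=
    Nat.Coprime.pow_left _ ((Nat.Prime.coprime_iff_not_dvd hp.out).mpr P.not_dvd_index)
  refine hcop.dvd_of_dvd_mul_right (h.trans ?_)
  have hG : Nat.card (MulAction.orbit G x) = (MulAction.stabilizer G x).index :=
    (MulAction.index_stabilizer G x).symm
  have hP : Nat.card (MulAction.orbit P x) =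
      (MulAction.stabilizer G x).relIndex (P : Subgroup G) :=
    (MulAction.index_stabilizer P x).symm
  rw [hG, hP, ← Subgroup.inf_relIndex_right, Subgroup.relIndex_mul_index inf_le_right]
  exact Subgroup.index_dvd_of_le inf_le_left

theorem rotate_one {d : ℕ} (x : EuclideanSpace ℝ (Fin d)) : rotate 1 x = x := by
  simp [rotate]

theorem rotate_mul {d : ℕ} (g h : Matrix.specialOrthogonalGroup (Fin d) ℝ)
    (x : EuclideanSpace ℝ (Fin d)) : rotate (g * h) x = rotate g (rotate h x) := by
  simp [rotate, Matrix.mulVec_mulVec]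

/-- The action of `SO(d)` on `ℝ^d` by rotations. -/
noncomputable instance rotateMulAction (d : ℕ) :
    MulAction (Matrix.specialOrthogonalGroup (Fin d) ℝ) (EuclideanSpace ℝ (Fin d)) where
  smul := rotate
  one_smul := rotate_one
  mul_smul := rotate_mul

/-- The standard representation of `SO(d)` on `ℝ^d`. -/
noncomputable def rotateRepresentation (d : ℕ) :
    Representation ℝ (Matrix.specialOrthogonalGroup (Fin d) ℝ) (EuclideanSpace ℝ (Fin d)) where
  toFun g :=
    { toFun := rotate g
      map_add' := fun x y ↦ by simp [rotate, Matrix.mulVec_add]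
      map_smul' := fun c x ↦ by simp [rotate, Matrix.mulVec_smul] }
  map_one' := LinearMap.ext rotate_one
  map_mul' g h := LinearMap.ext (rotate_mul g h)

theorem norm_rotate {d : ℕ} (g : Matrix.specialOrthogonalGroup (Fin d) ℝ)
    (x : EuclideanSpace ℝ (Fin d)) : ‖rotate g x‖ = ‖x‖ := by
  have hg : (g : Matrix (Fin d) (Fin d) ℝ).transpose * g = 1 :=
    (Matrix.mem_orthogonalGroup_iff' (Fin d) ℝ).mp (Matrix.mem_specialOrthogonalGroup_iff.mp g.2).1
  have hnorm : ∀ y : EuclideanSpace ℝ (Fin d), ‖y‖ ^ 2 = y.ofLp ⬝ᵥ y.ofLp := fun y ↦ by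
    rw [EuclideanSpace.real_norm_sq_eq]
    simp [dotProduct, sq]
  refine (sq_eq_sq₀ (norm_nonneg _) (norm_nonneg _)).mp ?_
  rw [hnorm, hnorm]
  simp only [rotate]
  rw [Matrix.dotProduct_mulVec, Matrix.vecMul_mulVec, hg, Matrix.vecMul_one]

/-- A nilpotent subgroup `P` of a group of rotations of an odd-dimensional Euclidean space has an
orbit of size one or two on the unit sphere. -/
theorem exists_norm_eq_one_card_orbit_dvd_two {d : ℕ} (hodd : Odd d)
    {G : Subgroup (Matrix.specialOrthogonalGroup (Fin d) ℝ)} (P : Subgroup G)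
    [Group.IsNilpotent P] :
    ∃ w : EuclideanSpace ℝ (Fin d), ‖w‖ = 1 ∧ Nat.card (MulAction.orbit P w) ∣ 2 := by
  obtain ⟨v, hv, h⟩ := Representation.exists_common_eigenvector_of_isNilpotent d
    ((rotateRepresentation d).comp (G.subtype.comp P.subtype)) (by simp) hodd
  have hw : ‖(‖v‖⁻¹ • v)‖ = 1 := by
    rw [norm_smul, norm_inv, norm_norm, inv_mul_cancel₀ (norm_ne_zero_iff.mpr hv)]
  refine ⟨‖v‖⁻¹ • v, hw, ?_⟩
  have hsub : MulAction.orbit P (‖v‖⁻¹ • v) ⊆ {‖v‖⁻¹ • v, -(‖v‖⁻¹ • v)} := by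
    rintro _ ⟨g, rfl⟩
    obtain ⟨c, hc⟩ := h g
    have hgw : rotate ((g : G) : Matrix.specialOrthogonalGroup (Fin d) ℝ) (‖v‖⁻¹ • v) =
        c • (‖v‖⁻¹ • v) := by
      rw [smul_comm, ← hc]
      exact (rotateRepresentation d _).map_smul _ _
    -- Rotations preserve the norm, so the only possible eigenvalues are `1` and `-1`.
    have hc1 : |c| = 1 := by
      have := norm_rotate ((g : G) : Matrix.specialOrthogonalGroup (Fin d) ℝ) (‖v‖⁻¹ • v)
      rwa [hgw, norm_smul, hw, mul_one, Real.norm_eq_abs] at this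
    change rotate ((g : G) : Matrix.specialOrthogonalGroup (Fin d) ℝ) (‖v‖⁻¹ • v) ∈ _
    rw [hgw]
    rcases eq_or_eq_neg_of_abs_eq hc1 with rfl | rfl <;> simp
  have hfinite : (MulAction.orbit P (‖v‖⁻¹ • v)).Finite := (Set.toFinite _).subset hsub
  have hpos : 0 < (MulAction.orbit P (‖v‖⁻¹ • v)).ncard :=
    (Set.ncard_pos hfinite).mpr ⟨_, MulAction.mem_orbit_self _⟩
  have hle : (MulAction.orbit P (‖v‖⁻¹ • v)).ncard ≤ 2 := (Set.ncard_le_ncard hsub).trans (Set.ncard_insert_le _ _ |>.trans (by simp))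
  change (MulAction.orbit P (‖v‖⁻¹ • v)).ncard ∣ 2
  interval_cases (MulAction.orbit P (‖v‖⁻¹ • v)).ncard <;> decide

theorem proposition1p5 (d r : ℕ) (hd : 3 ≤ d) (hodd : Odd d) (hr : 3 ≤ r)
    (γ : Fin r → Matrix.specialOrthogonalGroup (Fin d) ℝ)
    (hfin : (Subgroup.closure (Set.range γ) :
      Set (Matrix.specialOrthogonalGroup (Fin d) ℝ)).Finite) :
    ¬ SphereDivisible γ := by
  rintro ⟨A, -, hA⟩
  set G := Subgroup.closure (Set.range γ) with hG
  have : Finite G := hfin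
  have hdvd : ∀ x : EuclideanSpace ℝ (Fin d), ‖x‖ = 1 → r ∣ Nat.card (MulAction.orbit G x) := by
    intro x hx
    refine MulAction.dvd_card_orbit_of_existsUnique
      (fun i ↦ (⟨γ i, Subgroup.subset_closure ⟨i, rfl⟩⟩ : G)) A x ?_
    rintro _ ⟨g, rfl⟩
    exact hA _ (mem_sphere_zero_iff_norm.mpr ((norm_rotate _ x).trans hx))
  have hr2 : r ∣ 2 := by
    refine (Nat.dvd_iff_prime_pow_dvd_dvd 2 r).mpr fun p k hp hpk ↦ ?_
    have : Fact p.Prime := ⟨hp⟩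
    obtain ⟨P⟩ : Nonempty (Sylow p G) := inferInstance
    have : Group.IsNilpotent P := P.isPGroup'.isNilpotent
    obtain ⟨w, hw, hcard⟩ := exists_norm_eq_one_card_orbit_dvd_two hodd (P : Subgroup G)
    exact (P.pow_dvd_card_orbit w (hpk.trans (hdvd w hw))).trans hcard
  exact absurd (Nat.le_of_dvd two_pos hr2) (by omega)
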